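/- Let $M$ be a smooth $n$-dimensional (Hausdorff) manifold, $J$ an almost complex structure on $M$ (a smooth field of endomorphisms of $TM$ with $J^2=-\mathrm{Id}$), and $\nabla$ a smooth connection on $TM$ with torsion $T$. Put $\widetilde\nabla:=\nabla-\tfrac12T$. Let $\pi:T^*M\to M$ be the projection, $\theta$ the Liouville form, and $\omega_{st}=d\theta$. * For a $(1,1)$-tensor $R$ on $M$, let $\theta(R)$ be the one-form on $T^*M$ given by $\theta(R)_\xi(Y)=\xi(R(d\pi Y))$. The complete lift $J^c$ is the $(1,1)$-tensor on $T^*M$ determined by $d(\theta(J))=\omega_{st}(J^c\cdot,\cdot)$. * For a $(1,2)$-tensor $R$ on $M$, let $\gamma(R)$ be the $(1,1)$-tensor on $T^*M$ such that $\gamma(R)_\xi(Y)$ is the vertical vector at $\xi$ corresponding to the covector $\xi(R(d\pi Y,\cdot))$. Let $(\widetilde\nabla J)(X,Y)=\widetilde\nabla_X(JY)-J\widetilde\nabla_XY$ and $[\widetilde\nabla J](X,Y)=-(\widetilde\nabla J)(X,Y)+(\widetilde\nabla J)(Y,X)$. The Ishihara–Yano horizontal lift of $J$ is $J^{H,\nabla}:=J^c+\gamma([\widetilde\nabla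 J])$. * For a connection $\nabla'$ on $TM$, with the induced connection $(\nabla'_Xs)(Y)=X.s(Y)-s(\nabla'_XY)$ on $T^*M$, let $H^{\nabla'}_\xi=\{d_xs(X): X\in T_xM,\ s\in\Gamma(T^*M),\ s(x)=\xi,\ \nabla'_Xs=0\}$, where $x=\pi(\xi)$. The generalized horizontal lift $J^{G,\nabla'}$ is the field of endomorphisms of $T(T^*M)$ equal to $J\oplus{}^tJ$ in the decomposition $T_\xi T^*M=H^{\nabla'}_\xi\oplus T_x^*M$: it maps $h+\alpha$ to $h'+\alpha\circ J$, where $h'\in H^{\nabla'}_\xi$ is the horizontal vector with $d\pi(h')=J\,d\pi(h)$. Then $J^c$ and $J^{G,\widetilde\nabla}$ are well defined (each exists and is unique), and $$J^{H,\nabla}=J^{G,\widetilde\nabla}.$$ -/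

import Mathlib

open Bundle FiberBundle
open scoped Manifold ContDiff

noncomputable section

namespace CotangentLift

/-! ### The exterior derivative of a one-form on a manifold without boundary -/

section ExteriorDerivative

variable {E : Type*} [NormedAddCommGroup E] [NormedSpace ℝ E]
  {H : Type*} [TopologicalSpace H] (I : ModelWithCorners ℝ E H)
  {N : Type*} [TopologicalSpace N] [ChartedSpace H N]

/-- The expression of a one-form `α` in the preferred chart `φ` at `x₀`: the pullback of `α` by
`φ⁻¹`, a one-form on the model space (meaningful on the target of `φ`). -/
def oneFormInChart (α : ∀ x : N, TangentSpace I x →L[ℝ] ℝ) (x₀ : N) :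
    E → E [⋀^Fin 1]→L[ℝ] ℝ := fun y =>
  ContinuousAlternatingMap.ofSubsingleton ℝ E ℝ (0 : Fin 1)
    ((α ((extChartAt I x₀).symm y)).comp (mfderiv 𝓘(ℝ, E) I (extChartAt I x₀).symm y))

/-- The exterior derivative `dα` of a one-form `α` on a manifold without boundary, evaluated at a
pair of tangent vectors at `x`: the exterior derivative in the model space of the expression of `α`
in the chart `φ` at `x`, pulled back by `φ`. -/
def extDerivOneForm (α : ∀ x : N, TangentSpace I x →L[ℝ] ℝ) (x : N)
    (v w : TangentSpace I x) : ℝ :=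
  extDeriv (oneFormInChart I α x) (extChartAt I x x)
    ![mfderiv I 𝓘(ℝ, E) (extChartAt I x) x v, mfderiv I 𝓘(ℝ, E) (extChartAt I x) x w]

end ExteriorDerivative

/-! ### The cotangent bundle -/

section Cotangent

variable (n : ℕ) (M : Type*) [TopologicalSpace M] [ChartedSpace (EuclideanSpace ℝ (Fin n)) M]

/-- The model fibre of the cotangent bundle: the dual of `ℝⁿ`. -/
abbrev Dual : Type := EuclideanSpace ℝ (Fin n) →L[ℝ] ℝ

variable {M}

/-- The cotangent space `T*ₓM`. -/
abbrev CotangentSpace (x : M) : Type := TangentSpace (𝓡 n) x →L[ℝ] Bundle.Trivial M ℝ x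

variable (M)

/-- The cotangent bundle `T*M`, as a manifold modelled on `ℝⁿ × (ℝⁿ)*`. -/
abbrev CotangentBundle : Type _ := TotalSpace (Dual n) (CotangentSpace n : M → Type)

/-- The model with corners of `T*M`. -/
abbrev cotModel : ModelWithCorners ℝ (EuclideanSpace ℝ (Fin n) × Dual n)
    (ModelProd (EuclideanSpace ℝ (Fin n)) (Dual n)) :=
  (𝓡 n).prod 𝓘(ℝ, Dual n)

variable [IsManifold (𝓡 n) ∞ M]

variable {n M}

/-- The differential at `ξ` of the projection `π : T*M → M`. -/
def dπ (ξ : CotangentBundle n M) :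
    TangentSpace (cotModel n) ξ →L[ℝ] TangentSpace (𝓡 n) ξ.proj :=
  mfderiv (cotModel n) (𝓡 n) (TotalSpace.proj : CotangentBundle n M → M) ξ

/-- The canonical embedding of `T*ₓM`, where `x = π(ξ)`, into `T_ξ T*M` as the vertical space: the
differential at `ξ` of the inclusion of the fibre `T*ₓM` into `T*M`. -/
def vert (ξ : CotangentBundle n M) :
    CotangentSpace n ξ.proj →L[ℝ] TangentSpace (cotModel n) ξ :=
  mfderiv 𝓘(ℝ, Dual n) (cotModel n)
    (fun p : Dual n => (TotalSpace.mk ξ.proj p : CotangentBundle n M)) ξ.snd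

/-- For a field of endomorphisms `R` of `TM`, the one-form `θ(R)` on `T*M`,
`θ(R)_ξ(Y) = ξ(R(dπ Y))`; in coordinates `p_k R^k_l dx^l`. -/
def thetaForm (R : ∀ x : M, TangentSpace (𝓡 n) x →L[ℝ] TangentSpace (𝓡 n) x)
    (ξ : CotangentBundle n M) : TangentSpace (cotModel n) ξ →L[ℝ] ℝ :=
  ξ.snd.comp ((R ξ.proj).comp (dπ ξ))

/-- The Liouville form `θ` of `T*M`, `θ_ξ(Y) = ξ(dπ Y)`. -/
def liouville (ξ : CotangentBundle n M) : TangentSpace (cotModel n) ξ →L[ℝ] ℝ :=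
  ξ.snd.comp (dπ ξ)

/-- The canonical symplectic form `ω = dθ` of `T*M`. -/
def omegaSt (ξ : CotangentBundle n M) (Y Z : TangentSpace (cotModel n) ξ) : ℝ :=
  extDerivOneForm (cotModel n) (liouville (n := n) (M := M)) ξ Y Z

/-- The contraction `γ(R)`, a field of endomorphisms of `T(T*M)`, of a tensor `R` of type `(1,2)`
on `M`: `γ(R)(Y)` is the vertical vector given by the covector `ξ(R(dπ Y, ·))`; in coordinates
`p_k R^k_{ij} dx^i ⊗ ∂p_j`. -/
def gammaContraction
    (R : ∀ x : M, TangentSpace (𝓡 n) x →L[ℝ] TangentSpace (𝓡 n) x →L[ℝ] TangentSpace (𝓡 n) x)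
    (ξ : CotangentBundle n M) :
    TangentSpace (cotModel n) ξ →L[ℝ] TangentSpace (cotModel n) ξ :=
  (vert ξ).comp
    ((ContinuousLinearMap.compL ℝ (EuclideanSpace ℝ (Fin n)) (EuclideanSpace ℝ (Fin n)) ℝ
      ξ.snd).comp ((R ξ.proj).comp (dπ ξ)))

end Cotangent

/-! ### Almost complex structures and connections -/

section Swap

variable {n : ℕ} {M : Type*} [TopologicalSpace M] [ChartedSpace (EuclideanSpace ℝ (Fin n)) M]

/-- Interchange of the two arguments of a bilinear map on a tangent space. -/
def swapArgs {x : M}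
    (B : TangentSpace (𝓡 n) x →L[ℝ] TangentSpace (𝓡 n) x →L[ℝ] TangentSpace (𝓡 n) x) :
    TangentSpace (𝓡 n) x →L[ℝ] TangentSpace (𝓡 n) x →L[ℝ] TangentSpace (𝓡 n) x :=
  let B' : EuclideanSpace ℝ (Fin n) →L[ℝ] EuclideanSpace ℝ (Fin n) →L[ℝ]
    EuclideanSpace ℝ (Fin n) := B
  B'.flip

@[simp] theorem swapArgs_apply {x : M}
    (B : TangentSpace (𝓡 n) x →L[ℝ] TangentSpace (𝓡 n) x →L[ℝ] TangentSpace (𝓡 n) x)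
    (u v : TangentSpace (𝓡 n) x) : swapArgs B u v = B v u := rfl

end Swap

section Base

variable (n : ℕ) (M : Type*) [TopologicalSpace M] [ChartedSpace (EuclideanSpace ℝ (Fin n)) M]
  [IsManifold (𝓡 n) ∞ M]

/-- An almost complex structure on `M`: a smooth field `J` of endomorphisms of the tangent spaces
with `J² = -Id`. -/
structure AlmostComplexStructure where
  toFun : ∀ x : M, TangentSpace (𝓡 n) x →L[ℝ] TangentSpace (𝓡 n) x
  smooth : ContMDiff (𝓡 n)
    ((𝓡 n).prod 𝓘(ℝ, EuclideanSpace ℝ (Fin n) →L[ℝ] EuclideanSpace ℝ (Fin n))) ∞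
    (fun x => TotalSpace.mk' (EuclideanSpace ℝ (Fin n) →L[ℝ] EuclideanSpace ℝ (Fin n))
      (E := fun y : M => TangentSpace (𝓡 n) y →L[ℝ] TangentSpace (𝓡 n) y) x (toFun x))
  sq_eq_neg : ∀ (x : M) (v : TangentSpace (𝓡 n) x), toFun x (toFun x v) = -v

instance : CoeFun (AlmostComplexStructure n M)
    (fun _ => ∀ x : M, TangentSpace (𝓡 n) x →L[ℝ] TangentSpace (𝓡 n) x) :=
  ⟨AlmostComplexStructure.toFun⟩

/-- Connections (covariant derivatives on the tangent bundle). The value of `∇_X Y` at `x` is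
written `∇ Y x (X x)`. -/
abbrev Connection :=
  CovariantDerivative (𝓡 n) (EuclideanSpace ℝ (Fin n)) (TangentSpace (𝓡 n) : M → Type)

variable {n M}

/-- The connection `∇̃ = ∇ - ½ T`, where `T` is the torsion of `∇`. -/
def symmetrized (nabla : Connection n M) : Connection n M :=
  nabla.addOneForm fun x => -(1 / 2 : ℝ) • swapArgs (nabla.torsion x)

theorem symmetrized_apply (nabla : Connection n M) (Y : ∀ x : M, TangentSpace (𝓡 n) x) (x : M)
    (u : TangentSpace (𝓡 n) x) :
    symmetrized nabla Y x u = nabla Y x u - (1 / 2 : ℝ) • nabla.torsion x u (Y x) := by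
  simp [symmetrized, CovariantDerivative.addOneForm, sub_eq_add_neg]

theorem nablaJ_tensorial (J : AlmostComplexStructure n M) (nabla : Connection n M) (x : M) :
    TensorialAt (𝓡 n) (EuclideanSpace ℝ (Fin n))
      (fun Y : ∀ x : M, TangentSpace (𝓡 n) x =>
        nabla (fun y => J y (Y y)) x - (J x).comp (nabla Y x)) x := by
  have hJ : ∀ {Y : ∀ x : M, TangentSpace (𝓡 n) x}, 
      MDifferentiableAt (𝓡 n) (𝓡 n).tangent (fun y => (TotalSpace.mk y (Y y) : TangentBundle (𝓡 n) M)) x →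
      
      MDifferentiableAt (𝓡 n) (𝓡 n).tangent (fun y => (TotalSpace.mk y (J y (Y y)) : TangentBundle (𝓡 n) M)) x := fun hY =>
    ((J.smooth x).mdifferentiableAt (by simp)).clm_bundle_apply hY
  constructor
  · intro f Y hf hY
    have h1 : (fun y => J y ((f • Y) y)) = f • (fun y => J y (Y y)) := by
      ext1 y; simp
    simp only [h1]
    rw [nabla.isCovariantDerivativeOnUniv.leibniz (hJ hY) hf,
      nabla.isCovariantDerivativeOnUniv.leibniz hY hf]
    ext1 u
    simp [smul_sub]
  · intro Y Y' hY hY'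
    have h1 : (fun y => J y ((Y + Y') y)) = (fun y => J y (Y y)) + (fun y => J y (Y' y)) := by
      ext1 y; simp
    simp only [h1]
    rw [nabla.isCovariantDerivativeOnUniv.add (hJ hY) (hJ hY'),
      nabla.isCovariantDerivativeOnUniv.add hY hY']
    ext1 u
    simp
    abel

/-- The tensor `∇J`, `(∇J)(X, Y) = ∇_X (JY) - J ∇_X Y`. -/
def nablaJ (J : AlmostComplexStructure n M) (nabla : Connection n M) (x : M) :
    TangentSpace (𝓡 n) x →L[ℝ] TangentSpace (𝓡 n) x →L[ℝ] TangentSpace (𝓡 n) x :=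
  swapArgs (TensorialAt.mkHom _ x (nablaJ_tensorial J nabla x))

theorem nablaJ_apply (J : AlmostComplexStructure n M) (nabla : Connection n M) (x : M)
    (X Y : ∀ x : M, TangentSpace (𝓡 n) x) (hY : 
      MDifferentiableAt (𝓡 n) (𝓡 n).tangent (fun y => (TotalSpace.mk y (Y y) : TangentBundle (𝓡 n) M)) x) :
    nablaJ J nabla x (X x) (Y x) =
      nabla (fun y => J y (Y y)) x (X x) - J x (nabla Y x (X x)) := by
  rw [nablaJ, swapArgs_apply, TensorialAt.mkHom_apply _ hY]
  rfl

/-- The tensor `[∇J]`, `[∇J](X, Y) = -(∇J)(X, Y) + (∇J)(Y, X)`. -/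
def bracketNablaJ (J : AlmostComplexStructure n M) (nabla : Connection n M) (x : M) :
    TangentSpace (𝓡 n) x →L[ℝ] TangentSpace (𝓡 n) x →L[ℝ] TangentSpace (𝓡 n) x :=
  -nablaJ J nabla x + swapArgs (nablaJ J nabla x)

end Base

/-! ### The lifts -/

section Lifts

variable {n : ℕ} {M : Type*} [TopologicalSpace M] [ChartedSpace (EuclideanSpace ℝ (Fin n)) M]
  [IsManifold (𝓡 n) ∞ M]

variable (n M) in
/-- Fields of endomorphisms of the tangent spaces of `T*M`. -/
abbrev EndField : Type _ :=
  ∀ ξ : CotangentBundle n M, TangentSpace (cotModel n) ξ →L[ℝ] TangentSpace (cotModel n) ξ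

/-- `K` satisfies the identity `d(θ(J)) = ω(K ·, ·)` that defines the complete lift of `J`. -/
def IsCompleteLift (J : AlmostComplexStructure n M) (K : EndField n M) : Prop :=
  ∀ (ξ : CotangentBundle n M) (Y Z : TangentSpace (cotModel n) ξ),
    extDerivOneForm (cotModel n) (thetaForm (n := n) (M := M) J) ξ Y Z = omegaSt ξ (K ξ Y) Z

/-- The complete lift `Jᶜ`: the field determined by `d(θ(J)) = ω(Jᶜ ·, ·)`. -/
def completeLift (J : AlmostComplexStructure n M) : EndField n M :=
  Classical.epsilon (IsCompleteLift J)

/-- The horizontal lift `J^{H,∇} = Jᶜ + γ([∇̃J])` of Ishihara and Yano. -/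
def horizontalLift (J : AlmostComplexStructure n M) (nabla : Connection n M) : EndField n M :=
  fun ξ => completeLift J ξ + gammaContraction (bracketNablaJ J (symmetrized nabla)) ξ

/-- The connection induced on `T*M`: the value at `x` of `(∇_X s)(Y) = X.s(Y) - s(∇_X Y)`, where
`u` is the value of `X` at `x`. -/
def dualCov (nabla : Connection n M) (s : ∀ x : M, CotangentSpace n x)
    (Y : ∀ x : M, TangentSpace (𝓡 n) x) (x : M) (u : TangentSpace (𝓡 n) x) : ℝ :=
  mvfderiv (𝓡 n) (fun y => (s y (Y y) : ℝ)) x u - s x (nabla Y x u)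

/-- The horizontal distribution of `∇`:
`H_ξ = {dₓs(X) | X ∈ TₓM, s ∈ Γ(T*M), s(x) = ξ, ∇_X s = 0}`, where `x = π(ξ)`. -/
def horizontalSpace (nabla : Connection n M) (ξ : CotangentBundle n M) :
    Set (TangentSpace (cotModel n) ξ) :=
  {Z | ∃ (s : ∀ x : M, CotangentSpace n x) (u : TangentSpace (𝓡 n) ξ.proj),
    ContMDiff (𝓡 n) (cotModel n) ∞ (fun x => (TotalSpace.mk x (s x) : CotangentBundle n M)) ∧
    (∀ Y : ∀ x : M, TangentSpace (𝓡 n) x,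
      ContMDiff (𝓡 n) (𝓡 n).tangent ∞ (fun x => (TotalSpace.mk x (Y x) : TangentBundle (𝓡 n) M)) →
      dualCov nabla s Y ξ.proj u = 0) ∧
    tangentMap (𝓡 n) (cotModel n) (fun x => (TotalSpace.mk x (s x) : CotangentBundle n M))
      ⟨ξ.proj, u⟩ = ⟨ξ, Z⟩}

/-- `K` is the product structure `J ⊕ ᵗJ` with respect to the decompositions
`T_ξ T*M = H_ξ ⊕ T*ₓM`, `x = π(ξ)`: it maps `h + α` to `h' + α ∘ J`, where `h'` is the horizontal
vector with `dπ h' = J (dπ h)`. -/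
def IsGeneralizedHorizontalLift (J : AlmostComplexStructure n M) (nabla : Connection n M)
    (K : EndField n M) : Prop :=
  ∀ ξ : CotangentBundle n M, ∀ h ∈ horizontalSpace nabla ξ, ∀ h' ∈ horizontalSpace nabla ξ,
    dπ ξ h' = J ξ.proj (dπ ξ h) → ∀ α : CotangentSpace n ξ.proj,
      K ξ (h + vert ξ α) = h' + vert ξ (α.comp (J ξ.proj))

/-- The generalized horizontal lift `J^{G,∇}`. -/
def generalizedHorizontalLift (J : AlmostComplexStructure n M) (nabla : Connection n M) :
    EndField n M :=
  Classical.epsilon (IsGeneralizedHorizontalLift J nabla)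

end Lifts

end CotangentLift

end

/-!
A connection `D` splits `T_ξ T*M` as `TₓM × T*ₓM`, `x = π(ξ)`. In this splitting the canonical
symplectic form is `ω((u, α), (v, β)) = α(v) - β(u) + ξ(T(u, v))`, where `T` is the torsion of `D`,
and `d(θ(J))((u, α), (v, β)) = α(Jv) - β(Ju) + ξ(J T(u, v) - [DJ](u, v))`. As `ω` is non-degenerate,
comparing the two shows that `Jᶜ` exists, is unique, and maps `(u, α)` to
`(Ju, α ∘ J - ξ(S(u, ·)))`, where `S(u, v) = [DJ](u, v) + T(Ju, v) - J T(u, v)`. Hence `Jᶜ + γ(S)`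
is `J ⊕ ᵗJ` in the splitting, that is `J^{G,D}`. The connection `∇̃` is torsion free; for `D = ∇̃`
the tensor `S` is therefore `[∇̃J]`.

The spaces `TₓM` and `T_ξ T*M` are the model spaces of the preferred charts at `x` and `ξ`, so the
pointwise identities are checked there, by comparing `D` with the derivative in the chart.
-/

noncomputable section

namespace CotangentLift

/-! ### Sections in preferred trivializations -/

section Sections

variable {𝕜 : Type*} [NontriviallyNormedField 𝕜]
  {E : Type*} [NormedAddCommGroup E] [NormedSpace 𝕜 E]
  {H : Type*} [TopologicalSpace H] {I : ModelWithCorners 𝕜 E H}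
  {M : Type*} [TopologicalSpace M] [ChartedSpace H M]

theorem mvfderiv_congr {F : Type*} [NormedAddCommGroup F] [NormedSpace 𝕜 F] {f g : M → F} {x : M}
    (h : f =ᶠ[nhds x] g) : mvfderiv I f x = mvfderiv I g x := by
  rw [mvfderiv, mvfderiv, h.mfderiv_eq, h.self_of_nhds]

theorem mvfderiv_clm_apply {F G : Type*} [NormedAddCommGroup F] [NormedSpace 𝕜 F]
    [NormedAddCommGroup G] [NormedSpace 𝕜 G] {A : M → F →L[𝕜] G} {f : M → F} {x : M}
    (hA : MDifferentiableAt I 𝓘(𝕜, F →L[𝕜] G) A x) (hf : MDifferentiableAt I 𝓘(𝕜, F) f x)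
    (u : TangentSpace I x) :
    mvfderiv I (fun y => A y (f y)) x u = mvfderiv I A x u (f x) + A x (mvfderiv I f x u) := by
  have h : HasMFDerivAt I 𝓘(𝕜, G) (fun y => A y (f y)) x _ :=
    ⟨(hA.clm_apply hf).continuousAt, hA.hasMFDerivAt.2.clm_apply hf.hasMFDerivAt.2⟩
  have key := congrArg (fun L : E →L[𝕜] G => L u) h.mfderiv
  simp only [writtenInExtChartAt, extChartAt_model_space_eq_id, PartialEquiv.refl_coe,
    Function.comp_apply, extChartAt_to_inv, id_eq] at key
  exact key.trans (add_comm _ _)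

variable {F : Type*} [NormedAddCommGroup F] [NormedSpace 𝕜 F]
  {V : M → Type*} [TopologicalSpace (TotalSpace F V)] [∀ x, TopologicalSpace (V x)]
  [FiberBundle F V]

variable (F) in
/-- The expression of a section `σ` in the preferred trivialization at `x₀`, a function with values
in the model fibre (meaningful on the base set of the trivialization). -/
def localExpr (x₀ : M) (σ : ∀ x, V x) (x : M) : F :=
  (trivializationAt F V x₀ ⟨x, σ x⟩).2

theorem mdifferentiableAt_localExpr {σ : ∀ x, V x} {x : M} (hσ : MDiffAt (T% σ) x) :
    MDifferentiableAt I 𝓘(𝕜, F) (localExpr F x σ) x :=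
  ((mdifferentiableAt_totalSpace I _).1 hσ).2

theorem eventually_mem_baseSet (x : M) :
    ∀ᶠ y in nhds x, y ∈ (trivializationAt F V x).baseSet :=
  (trivializationAt F V x).open_baseSet.mem_nhds (mem_baseSet_trivializationAt' x)

variable [∀ x, AddCommGroup (V x)] [∀ x, Module 𝕜 (V x)] [VectorBundle 𝕜 F V]

variable (𝕜) in
theorem continuousLinearMapAt_eq_localExpr (σ : ∀ x, V x) {x₀ x : M}
    (hx : x ∈ (trivializationAt F V x₀).baseSet) :
    (trivializationAt F V x₀).continuousLinearMapAt 𝕜 x (σ x) = localExpr F x₀ σ x := by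
  rw [Trivialization.continuousLinearMapAt_apply, Trivialization.coe_linearMapAt_of_mem _ hx]
  rfl

variable (𝕜) in
theorem symmL_localExpr_self (σ : ∀ x, V x) (x : M) :
    (trivializationAt F V x).symmL 𝕜 x (localExpr F x σ x) = σ x := by
  rw [← continuousLinearMapAt_eq_localExpr 𝕜 σ (mem_baseSet_trivializationAt' x),
    Trivialization.symmL_continuousLinearMapAt _ (mem_baseSet_trivializationAt' x)]

variable (𝕜) in
include 𝕜 in
theorem localExpr_add (σ τ : ∀ x, V x) {x₀ x : M} (hx : x ∈ (trivializationAt F V x₀).baseSet) :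
    localExpr F x₀ (σ + τ) x = localExpr F x₀ σ x + localExpr F x₀ τ x := by
  simp only [← continuousLinearMapAt_eq_localExpr 𝕜 _ hx, Pi.add_apply, map_add]

theorem localExpr_smul (f : M → 𝕜) (σ : ∀ x, V x) {x₀ x : M}
    (hx : x ∈ (trivializationAt F V x₀).baseSet) :
    localExpr F x₀ (f • σ) x = f x • localExpr F x₀ σ x := by
  simp only [← continuousLinearMapAt_eq_localExpr 𝕜 _ hx, Pi.smul_apply', map_smul]

variable [∀ x, IsTopologicalAddGroup (V x)] [∀ x, ContinuousSMul 𝕜 (V x)]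

variable (I F V) in
/-- The connection that differentiates a section, at each point `x`, in the preferred trivialization
at `x`. Since this trivialization jumps with `x`, the connection is not continuous; it serves as
the origin from which the other connections are measured, by their Christoffel symbols. -/
def flatConnection : CovariantDerivative I F V where
  toFun σ x := ((trivializationAt F V x).symmL 𝕜 x).comp (mvfderiv I (localExpr F x σ) x)
  isCovariantDerivativeOnUniv :=
    { add := by
        intro σ τ x hσ hτ _
        have h : localExpr F x (σ + τ) =ᶠ[nhds x] localExpr F x σ + localExpr F x τ :=
          (eventually_mem_baseSet x).mono fun y hy => localExpr_add 𝕜 σ τ hy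
        rw [mvfderiv_congr h, mvfderiv_add (mdifferentiableAt_localExpr hσ)
          (mdifferentiableAt_localExpr hτ), ContinuousLinearMap.comp_add]
      leibniz := by
        intro σ g x hσ hg _
        have h : localExpr F x (g • σ) =ᶠ[nhds x] g • localExpr F x σ :=
          (eventually_mem_baseSet x).mono fun y hy => localExpr_smul g σ hy
        rw [mvfderiv_congr h, mvfderiv_smul hg (mdifferentiableAt_localExpr hσ)]
        ext1 u
        simp [symmL_localExpr_self 𝕜 σ x] }

theorem flatConnection_apply (σ : ∀ x, V x) (x : M) (u : TangentSpace I x) :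
    flatConnection I F V σ x u =
      (trivializationAt F V x).symmL 𝕜 x (mvfderiv I (localExpr F x σ) x u) :=
  rfl

section Product

variable {F₁ : Type*} [NormedAddCommGroup F₁] [NormedSpace 𝕜 F₁]
  {V₁ : M → Type*} [TopologicalSpace (TotalSpace F₁ V₁)] [∀ x, TopologicalSpace (V₁ x)]
  [∀ x, AddCommGroup (V₁ x)] [∀ x, Module 𝕜 (V₁ x)] [FiberBundle F₁ V₁] [VectorBundle 𝕜 F₁ V₁]

theorem localExpr_hom (R : ∀ x, V₁ x →L[𝕜] V x) (x₀ x : M) (a : F₁) :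
    localExpr (F₁ →L[𝕜] F) x₀ R x a = (trivializationAt F V x₀).continuousLinearMapAt 𝕜 x
      (R x ((trivializationAt F₁ V₁ x₀).symmL 𝕜 x a)) := by
  rw [localExpr, hom_trivializationAt_apply]
  rfl

theorem symmL_hom_apply {x₀ x : M} (h₁ : x ∈ (trivializationAt F₁ V₁ x₀).baseSet)
    (h : x ∈ (trivializationAt F V x₀).baseSet) (A : F₁ →L[𝕜] F) (v : V₁ x) :
    (trivializationAt (F₁ →L[𝕜] F) (fun y => V₁ y →L[𝕜] V y) x₀).symmL 𝕜 x A v =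
      (trivializationAt F V x₀).symmL 𝕜 x
        (A ((trivializationAt F₁ V₁ x₀).continuousLinearMapAt 𝕜 x v)) := by
  have hx : x ∈
      (trivializationAt (F₁ →L[𝕜] F) (fun y => V₁ y →L[𝕜] V y) x₀).baseSet := ⟨h₁, h⟩
  rw [Trivialization.symmL_apply _ hx]
  exact DFunLike.congr_fun (Pretrivialization.continuousLinearMap_symm_apply' (RingHom.id 𝕜)
    (trivializationAt F₁ V₁ x₀) (trivializationAt F V x₀) ⟨h₁, h⟩ A) v

theorem localExpr_clm_apply (R : ∀ x, V₁ x →L[𝕜] V x) (σ : ∀ x, V₁ x) {x₀ x : M}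
    (h₁ : x ∈ (trivializationAt F₁ V₁ x₀).baseSet) (h : x ∈ (trivializationAt F V x₀).baseSet) :
    localExpr (F₁ →L[𝕜] F) x₀ R x (localExpr F₁ x₀ σ x) =
      localExpr F x₀ (fun y => R y (σ y)) x := by
  rw [localExpr_hom, ← continuousLinearMapAt_eq_localExpr 𝕜 σ h₁,
    Trivialization.symmL_continuousLinearMapAt _ h₁,
    continuousLinearMapAt_eq_localExpr 𝕜 (fun y => R y (σ y)) h]

theorem flatConnection_clm_apply [∀ x, IsTopologicalAddGroup (V₁ x)] [∀ x, ContinuousSMul 𝕜 (V₁ x)]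
    {R : ∀ x, V₁ x →L[𝕜] V x} {σ : ∀ x, V₁ x} {x : M}
    (hR : MDifferentiableAt I (I.prod 𝓘(𝕜, F₁ →L[𝕜] F)) (fun y =>
      TotalSpace.mk' (F₁ →L[𝕜] F) (E := fun y => V₁ y →L[𝕜] V y) y (R y)) x) (hσ : MDiffAt (T% σ) x)
    (u : TangentSpace I x) :
    flatConnection I F V (fun y => R y (σ y)) x u =
      flatConnection I (F₁ →L[𝕜] F) (fun y => V₁ y →L[𝕜] V y) R x u (σ x) +
        R x (flatConnection I F₁ V₁ σ x u) := by
  have h₁ := mem_baseSet_trivializationAt F₁ V₁ x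
  have h := mem_baseSet_trivializationAt F V x
  have hloc : localExpr F x (fun y => R y (σ y)) =ᶠ[nhds x]
      fun y => localExpr (F₁ →L[𝕜] F) x R y (localExpr F₁ x σ y) := by
    filter_upwards [eventually_mem_baseSet (F := F) (V := V) x,
      eventually_mem_baseSet (F := F₁) (V := V₁) x] with y hy hy₁
    exact (localExpr_clm_apply R σ hy₁ hy).symm
  rw [flatConnection_apply, mvfderiv_congr hloc,
    mvfderiv_clm_apply (mdifferentiableAt_localExpr hR) (mdifferentiableAt_localExpr hσ), map_add,
    flatConnection_apply, symmL_hom_apply h₁ h, continuousLinearMapAt_eq_localExpr 𝕜 σ h₁,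
    localExpr_hom, Trivialization.symmL_continuousLinearMapAt _ h, flatConnection_apply]

end Product
end Sections

/-! ### Christoffel symbols -/

section Christoffel

variable {𝕜 : Type*} [NontriviallyNormedField 𝕜] [CompleteSpace 𝕜]
  {E : Type*} [NormedAddCommGroup E] [NormedSpace 𝕜 E]
  {H : Type*} [TopologicalSpace H] {I : ModelWithCorners 𝕜 E H}
  {M : Type*} [TopologicalSpace M] [ChartedSpace H M]
  {F : Type*} [NormedAddCommGroup F] [NormedSpace 𝕜 F] [FiniteDimensional 𝕜 F]
  {V : M → Type*} [TopologicalSpace (TotalSpace F V)] [∀ x, AddCommGroup (V x)]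
  [∀ x, Module 𝕜 (V x)] [∀ x, TopologicalSpace (V x)] [∀ x, IsTopologicalAddGroup (V x)]
  [∀ x, ContinuousSMul 𝕜 (V x)] [FiberBundle F V] [VectorBundle 𝕜 F V]
  [ContMDiffVectorBundle 1 F V I]

/-- The Christoffel symbols `Γ` of a connection `D`, at each `x` in the preferred trivialization at
`x`; the argument to be differentiated comes first, `D_X σ = ∂_X σ + Γ(σ, X)`. -/
def christoffel (D : CovariantDerivative I F V) (x : M) : V x →L[𝕜] TangentSpace I x →L[𝕜] V x :=
  D.difference (flatConnection I F V) x

theorem covariantDerivative_apply (D : CovariantDerivative I F V) {σ : ∀ x, V x} {x : M}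
    (hσ : MDiffAt (T% σ) x) (u : TangentSpace I x) :
    D σ x u = flatConnection I F V σ x u + christoffel D x (σ x) u := by
  have h : christoffel D x (σ x) = D σ x - flatConnection I F V σ x :=
    D.isCovariantDerivativeOnUniv.difference_apply
      (flatConnection I F V).isCovariantDerivativeOnUniv (Set.mem_univ x) hσ
  rw [h, sub_apply, add_sub_cancel]

end Christoffel

section TangentBundle

variable {𝕜 : Type*} [NontriviallyNormedField 𝕜]
  {E : Type*} [NormedAddCommGroup E] [NormedSpace 𝕜 E]
  {H : Type*} [TopologicalSpace H] {I : ModelWithCorners 𝕜 E H}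
  {M : Type*} [TopologicalSpace M] [ChartedSpace H M]

theorem hasFDerivWithinAt_comp_extChartAt_symm {F : Type*} [NormedAddCommGroup F]
    [NormedSpace 𝕜 F] {f : M → F} {x : M} (hf : MDifferentiableAt I 𝓘(𝕜, F) f x) :
    HasFDerivWithinAt (f ∘ (extChartAt I x).symm) (mvfderiv I f x : E →L[𝕜] F) (Set.range I)
      (extChartAt I x x) :=
  hf.hasMFDerivAt.2

variable [IsManifold I 1 M]

theorem continuousLinearMapAt_tangent_self (x : M) (v : TangentSpace I x) :
    (trivializationAt E (TangentSpace I) x).continuousLinearMapAt 𝕜 x v = v := by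
  rw [TangentBundle.continuousLinearMapAt_trivializationAt (mem_chart_source H x)]
  exact DFunLike.congr_fun (mfderiv_extChartAt_self (I := I)) v

theorem symmL_tangent_self (x : M) (v : E) :
    (trivializationAt E (TangentSpace I) x).symmL 𝕜 x v = v :=
  (congrArg _ (continuousLinearMapAt_tangent_self (I := I) x v)).symm.trans
    (Trivialization.symmL_continuousLinearMapAt
      (trivializationAt E (TangentSpace I : M → Type _) x) (mem_baseSet_trivializationAt' x) v)

theorem flatConnection_tangent_apply (Y : ∀ x : M, TangentSpace I x) (x : M)
    (u : TangentSpace I x) :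
    flatConnection I E (TangentSpace I) Y x u = mvfderiv I (localExpr E x Y) x u :=
  symmL_tangent_self x _

theorem localExpr_tangent_self (Y : ∀ x : M, TangentSpace I x) (x : M) :
    localExpr E x Y x = Y x := by
  rw [← continuousLinearMapAt_eq_localExpr 𝕜 Y (mem_baseSet_trivializationAt' x)]
  exact continuousLinearMapAt_tangent_self x (Y x)

theorem mpullbackWithin_extChartAt_symm (Y : ∀ x : M, TangentSpace I x) {x : M} {y : E}
    (hy : y ∈ (extChartAt I x).target) :
    VectorField.mpullbackWithin 𝓘(𝕜, E) I (extChartAt I x).symm Y (Set.range I) y =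
      localExpr E x Y ((extChartAt I x).symm y) := by
  have hm : (extChartAt I x).symm y ∈ (chartAt H x).source := by
    simpa only [extChartAt_source] using (extChartAt I x).map_target hy
  rw [VectorField.mpullbackWithin_apply, ContinuousLinearMap.inverse_eq
    (mfderivWithin_extChartAt_symm_comp_mfderiv_extChartAt hy)
    (mfderiv_extChartAt_comp_mfderivWithin_extChartAt_symm hy),
    ← TangentBundle.continuousLinearMapAt_trivializationAt hm]
  exact continuousLinearMapAt_eq_localExpr (F := E) 𝕜 Y hm

theorem hasFDerivWithinAt_mpullbackWithin_extChartAt_symm {Y : ∀ x : M, TangentSpace I x} {x : M}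
    (hY : MDiffAt (T% Y) x) :
    HasFDerivWithinAt (F := E)
      (VectorField.mpullbackWithin 𝓘(𝕜, E) I (extChartAt I x).symm Y (Set.range I))
      (flatConnection I E (TangentSpace I) Y x : E →L[𝕜] E) (Set.range I) (extChartAt I x x) := by
  have hflat : (flatConnection I E (TangentSpace I) Y x : E →L[𝕜] E) =
      (mvfderiv I (localExpr E x Y) x : E →L[𝕜] E) :=
    ContinuousLinearMap.ext (flatConnection_tangent_apply Y x)
  rw [hflat]
  exact (hasFDerivWithinAt_comp_extChartAt_symm
    (mdifferentiableAt_localExpr hY)).congr_of_eventuallyEq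
    (Filter.mem_of_superset (extChartAt_target_mem_nhdsWithin x) fun y hy =>
      mpullbackWithin_extChartAt_symm Y hy)
    (mpullbackWithin_extChartAt_symm Y (mem_extChartAt_target x))

theorem mlieBracket_eq_flatConnection {X Y : ∀ x : M, TangentSpace I x} {x : M}
    (hX : MDiffAt (T% X) x) (hY : MDiffAt (T% Y) x) :
    VectorField.mlieBracket I X Y x = flatConnection I E (TangentSpace I) Y x (X x) -
      flatConnection I E (TangentSpace I) X x (Y x) := by
  let pull (Z : ∀ x : M, TangentSpace I x) : E → E :=
    VectorField.mpullbackWithin 𝓘(𝕜, E) I (extChartAt I x).symm Z (Set.range I)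
  have hpull (Z : ∀ x : M, TangentSpace I x) : pull Z (extChartAt I x x) = Z x := by
    refine (mpullbackWithin_extChartAt_symm Z (mem_extChartAt_target x)).trans ?_
    rw [extChartAt_to_inv, localExpr_tangent_self]
  have hU : UniqueDiffWithinAt 𝕜 (Set.range I) (extChartAt I x x) :=
    I.uniqueDiffOn _ (extChartAt_target_subset_range x (mem_extChartAt_target x))
  have hbracket : VectorField.mlieBracket I X Y x =
      VectorField.lieBracketWithin 𝕜 (pull X) (pull Y) (Set.range I) (extChartAt I x x) := by
    rw [← VectorField.mlieBracketWithin_univ, VectorField.mlieBracketWithin_apply,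
      mfderiv_extChartAt_self, Set.preimage_univ, Set.univ_inter]
    exact DFunLike.congr_fun ContinuousLinearMap.inverse_id _
  let A (Z : ∀ x : M, TangentSpace I x) : E →L[𝕜] E := flatConnection I E (TangentSpace I) Z x
  have hfderiv {Z : ∀ x : M, TangentSpace I x} (hZ : MDiffAt (T% Z) x) :
      fderivWithin 𝕜 (pull Z) (Set.range I) (extChartAt I x x) = A Z :=
    HasFDerivWithinAt.fderivWithin (E := E) (F := E)
      (hasFDerivWithinAt_mpullbackWithin_extChartAt_symm hZ) hU
  have hlie : VectorField.lieBracketWithin 𝕜 (pull X) (pull Y) (Set.range I) (extChartAt I x x) =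
      A Y (X x) - A X (Y x) := by
    rw [VectorField.lieBracketWithin_eq, ← hpull X, ← hpull Y, ← hfderiv hX, ← hfderiv hY]
  exact hbracket.trans hlie

variable [CompleteSpace 𝕜] [FiniteDimensional 𝕜 E] [IsManifold I 2 M]

theorem torsion_eq_christoffel [CompleteSpace E]
    (D : CovariantDerivative I E (TangentSpace I : M → Type _)) (x : M) (u v : TangentSpace I x) :
    D.torsion x u v = christoffel D x v u - christoffel D x u v := by
  have hu := mdifferentiableAt_extend I E u
  have hv := mdifferentiableAt_extend I E v
  have h := D.torsion_apply hu hv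
  rw [covariantDerivative_apply D hu, covariantDerivative_apply D hv,
    mlieBracket_eq_flatConnection hu hv] at h
  simp only [extend_apply_self] at h
  rw [h]
  abel

end TangentBundle

/-! ### Total spaces of vector bundles -/

section TotalSpace

variable {𝕜 : Type*} [NontriviallyNormedField 𝕜]
  {E : Type*} [NormedAddCommGroup E] [NormedSpace 𝕜 E]
  {H : Type*} [TopologicalSpace H] {I : ModelWithCorners 𝕜 E H}
  {M : Type*} [TopologicalSpace M] [ChartedSpace H M]
  {F : Type*} [NormedAddCommGroup F] [NormedSpace 𝕜 F]
  {V : M → Type*} [TopologicalSpace (TotalSpace F V)] [∀ x, TopologicalSpace (V x)]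
  [FiberBundle F V]

theorem mem_extChartAt_totalSpace_source {ξ ζ : TotalSpace F V} :
    ζ ∈ (extChartAt (I.prod 𝓘(𝕜, F)) ξ).source ↔
      ζ.proj ∈ (trivializationAt F V ξ.proj).baseSet ∧ ζ.proj ∈ (chartAt H ξ.proj).source := by
  rw [extChartAt_source, FiberBundle.chartedSpace_chartAt]
  simp +contextual only [mfld_simps, Trivialization.mem_source, and_congr_right_iff,
    Trivialization.coe_fst']

theorem extChartAt_totalSpace_apply {ξ ζ : TotalSpace F V}
    (hζ : ζ.proj ∈ (trivializationAt F V ξ.proj).baseSet) :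
    extChartAt (I.prod 𝓘(𝕜, F)) ξ ζ =
      (extChartAt I ξ.proj ζ.proj, (trivializationAt F V ξ.proj ζ).2) := by
  rw [FiberBundle.extChartAt, ← Trivialization.coe_fst' _ hζ]
  rfl

variable [∀ x, AddCommGroup (V x)] [∀ x, Module 𝕜 (V x)] [VectorBundle 𝕜 F V]
  [IsManifold I 1 M] [ContMDiffVectorBundle 1 F V I]

theorem mfderiv_extChartAt_comp_mfderiv_proj {ξ ζ : TotalSpace F V}
    (hζ : ζ ∈ (extChartAt (I.prod 𝓘(𝕜, F)) ξ).source) :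
    (mfderiv I 𝓘(𝕜, E) (extChartAt I ξ.proj) ζ.proj).comp
        (mfderiv (I.prod 𝓘(𝕜, F)) I (TotalSpace.proj : TotalSpace F V → M) ζ) =
      (ContinuousLinearMap.fst 𝕜 E F).comp
        (mfderiv (I.prod 𝓘(𝕜, F)) 𝓘(𝕜, E × F) (extChartAt (I.prod 𝓘(𝕜, F)) ξ) ζ) := by
  have hψ : MDifferentiableAt (I.prod 𝓘(𝕜, F)) 𝓘(𝕜, E × F) (extChartAt (I.prod 𝓘(𝕜, F)) ξ) ζ :=
    mdifferentiableAt_extChartAt (by simpa only [extChartAt_source] using hζ)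
  have hφ : MDifferentiableAt I 𝓘(𝕜, E) (extChartAt I ξ.proj) ζ.proj :=
    mdifferentiableAt_extChartAt (mem_extChartAt_totalSpace_source.1 hζ).2
  have hcomm : extChartAt I ξ.proj ∘ (TotalSpace.proj : TotalSpace F V → M) =ᶠ[nhds ζ]
      Prod.fst ∘ extChartAt (I.prod 𝓘(𝕜, F)) ξ := by
    filter_upwards [extChartAt_source_mem_nhds' hζ] with η hη
    exact (congrArg Prod.fst
      (extChartAt_totalSpace_apply (mem_extChartAt_totalSpace_source.1 hη).1)).symm
  have hfst : HasMFDerivAt 𝓘(𝕜, E × F) 𝓘(𝕜, E) Prod.fst (extChartAt (I.prod 𝓘(𝕜, F)) ξ ζ)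
      (ContinuousLinearMap.fst 𝕜 E F) := hasFDerivAt_fst.hasMFDerivAt
  have hleft := hφ.hasMFDerivAt.comp ζ (mdifferentiableAt_proj V).hasMFDerivAt
  exact hasMFDerivAt_unique hleft
    ((hfst.comp ζ hψ.hasMFDerivAt).congr_of_eventuallyEq hcomm)

theorem mfderiv_proj_apply (ξ : TotalSpace F V) (v : E × F) :
    mfderiv (I.prod 𝓘(𝕜, F)) I (TotalSpace.proj : TotalSpace F V → M) ξ v = v.1 := by
  have h := mfderiv_extChartAt_comp_mfderiv_proj
    (mem_extChartAt_source (I := I.prod 𝓘(𝕜, F)) ξ)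
  rw [mfderiv_extChartAt_self, mfderiv_extChartAt_self] at h
  exact DFunLike.congr_fun h v

theorem mfderiv_section_apply {s : ∀ x, V x} {x : M} (hs : MDiffAt (T% s) x)
    (u : TangentSpace I x) :
    mfderiv I (I.prod 𝓘(𝕜, F)) (fun y => (TotalSpace.mk y (s y) : TotalSpace F V)) x u =
      ((u, mvfderiv I (localExpr F x s) x u) : E × F) := by
  let f : M → TotalSpace F V := fun y => TotalSpace.mk y (s y)
  have hφ : MDifferentiableAt I 𝓘(𝕜, E) (extChartAt I x) x :=
    mdifferentiableAt_extChartAt (mem_chart_source _ _)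
  have hψ : MDifferentiableAt (I.prod 𝓘(𝕜, F)) 𝓘(𝕜, E × F) (extChartAt (I.prod 𝓘(𝕜, F)) (f x))
      (f x) := mdifferentiableAt_extChartAt (mem_chart_source _ _)
  have hloc : MDifferentiableAt I 𝓘(𝕜, F) (localExpr F x s) x := mdifferentiableAt_localExpr hs
  have hcomm : extChartAt (I.prod 𝓘(𝕜, F)) (f x) ∘ f =ᶠ[nhds x]
      fun y => (extChartAt I x y, localExpr F x s y) :=
    (eventually_mem_baseSet x).mono fun y hy => extChartAt_totalSpace_apply hy
  have hleft := hψ.hasMFDerivAt.comp (f := f) x hs.hasMFDerivAt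
  have hright : HasMFDerivAt I 𝓘(𝕜, E × F) (fun y => (extChartAt I x y, localExpr F x s y)) x _ :=
    ⟨hφ.continuousAt.prodMk hloc.continuousAt, hφ.hasMFDerivAt.2.prodMk hloc.hasMFDerivAt.2⟩
  rw [mfderiv_extChartAt_self] at hleft hright
  exact DFunLike.congr_fun (F := E →L[𝕜] E × F)
    (hasMFDerivAt_unique hleft (hright.congr_of_eventuallyEq hcomm)) u

end TotalSpace

section GlobalSections

variable {E : Type*} [NormedAddCommGroup E] [NormedSpace ℝ E] [FiniteDimensional ℝ E]
  {H : Type*} [TopologicalSpace H] {I : ModelWithCorners ℝ E H}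
  {M : Type*} [TopologicalSpace M] [ChartedSpace H M] [IsManifold I ∞ M] [T2Space M]
  {F : Type*} [NormedAddCommGroup F] [NormedSpace ℝ F] {V : M → Type*}
  [TopologicalSpace (TotalSpace F V)] [∀ x, AddCommGroup (V x)] [∀ x, Module ℝ (V x)]
  [∀ x, TopologicalSpace (V x)] [FiberBundle F V] [VectorBundle ℝ F V]
  [ContMDiffVectorBundle ∞ F V I]

theorem exists_contMDiff_section_localExpr_eventuallyEq {x : M} {f : M → F} {u : Set M}
    (hu : u ∈ nhds x) (hf : ContMDiffOn I 𝓘(ℝ, F) ∞ f u) :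
    ∃ s : ∀ m, V m, ContMDiff I (I.prod 𝓘(ℝ, F)) ∞ (T% s) ∧ localExpr F x s =ᶠ[nhds x] f := by
  let e := trivializationAt F V x
  have hx : x ∈ e.baseSet := mem_baseSet_trivializationAt' x
  have hw : interior u ∩ e.baseSet ∈ nhds x :=
    Filter.inter_mem (interior_mem_nhds.2 hu) (e.open_baseSet.mem_nhds hx)
  obtain ⟨χ, -, hχ⟩ := ((SmoothBumpFunction.nhds_basis_tsupport (I := I) x).mem_iff.1 hw)
  refine ⟨(χ : M → ℝ) • fun m => e.symm m (f m), ?_, ?_⟩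
  · refine ContMDiffOn.smul_section_of_tsupport (u := interior u ∩ e.baseSet)
      χ.contMDiff.contMDiffOn (isOpen_interior.inter e.open_baseSet) hχ fun m hm => ?_
    refine ((e.contMDiffAt_section_iff hm.2).2 ?_).contMDiffWithinAt
    refine ((hf m (interior_subset hm.1)).contMDiffAt
      (mem_interior_iff_mem_nhds.1 hm.1)).congr_of_eventuallyEq ?_
    filter_upwards [e.open_baseSet.mem_nhds hm.2] with y hy
    simp [hy]
  · filter_upwards [χ.eventuallyEq_one, e.open_baseSet.mem_nhds hx] with m hm hb
    have hsymm : ((χ : M → ℝ) • fun m => e.symm m (f m)) m = e.symm m (f m) := by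
      rw [Pi.smul_apply', hm, Pi.one_apply, one_smul]
    rw [localExpr, hsymm]
    exact congrArg Prod.snd (e.apply_mk_symm hb (f m))

theorem exists_contMDiff_section_mvfderiv_localExpr_eq (x : M) (p : V x)
    (L : E →L[ℝ] F) :
    ∃ s : ∀ m, V m, ContMDiff I (I.prod 𝓘(ℝ, F)) ∞ (T% s) ∧ s x = p ∧
      mvfderiv I (localExpr F x s) x = L := by
  let e := trivializationAt F V x
  have hx : x ∈ e.baseSet := mem_baseSet_trivializationAt' x
  let c : F := (e ⟨x, p⟩).2
  let g : E → F := fun y => c + L (y - extChartAt I x x)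
  have hg : ContDiff ℝ ∞ g :=
    contDiff_const.add (L.contDiff.comp (contDiff_id.sub contDiff_const))
  have hg' : HasFDerivAt g L (extChartAt I x x) :=
    (L.hasFDerivAt.comp _ ((hasFDerivAt_id _).sub_const _)).const_add _
  have hf : ContMDiffOn I 𝓘(ℝ, F) ∞ (g ∘ extChartAt I x) (chartAt H x).source :=
    hg.contMDiff.comp_contMDiffOn contMDiffOn_extChartAt
  obtain ⟨s, hs, hsf⟩ :=
    exists_contMDiff_section_localExpr_eventuallyEq (V := V) (chart_source_mem_nhds H x) hf
  refine ⟨s, hs, ?_, ?_⟩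
  · have hsx : localExpr F x s x = c := hsf.self_of_nhds.trans (by simp [g])
    exact (e.symm_apply_apply_mk hx (s x)).symm.trans
      ((congrArg (e.symm x) hsx).trans (e.symm_apply_apply_mk hx p))
  · have hφ : HasMFDerivAt I 𝓘(ℝ, E) (extChartAt I x) x (ContinuousLinearMap.id ℝ E) :=
      mfderiv_extChartAt_self (I := I) (x := x) ▸
        (mdifferentiableAt_extChartAt (mem_chart_source H x)).hasMFDerivAt
    exact (mvfderiv_congr hsf).trans (hg'.hasMFDerivAt.comp x hφ).mfderiv

end GlobalSections

section Base

variable {n : ℕ} {M : Type*} [TopologicalSpace M] [ChartedSpace (EuclideanSpace ℝ (Fin n)) M]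
  [IsManifold (𝓡 n) ∞ M]

theorem torsion_symmetrized (nabla : Connection n M) : (symmetrized nabla).torsion = 0 := by
  ext x u v
  have hu := mdifferentiableAt_extend (𝓡 n) (EuclideanSpace ℝ (Fin n)) u
  have hv := mdifferentiableAt_extend (𝓡 n) (EuclideanSpace ℝ (Fin n)) v
  have h := (symmetrized nabla).torsion_apply hu hv
  have h' := nabla.torsion_apply hu hv
  rw [symmetrized_apply, symmetrized_apply] at h
  simp only [extend_apply_self] at h h'
  rw [h, nabla.torsion_antisymm v u, h', Pi.zero_apply, zero_apply, zero_apply]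
  module

variable (n) in
/-- The derivative of a field of endomorphisms of `TM`, taken at each point `x` in the preferred
trivialization at `x`. -/
abbrev flatDerivEnd (R : ∀ x : M, TangentSpace (𝓡 n) x →L[ℝ] TangentSpace (𝓡 n) x) (x : M) :
    TangentSpace (𝓡 n) x →L[ℝ] TangentSpace (𝓡 n) x →L[ℝ] TangentSpace (𝓡 n) x :=
  flatConnection (𝓡 n) (EuclideanSpace ℝ (Fin n) →L[ℝ] EuclideanSpace ℝ (Fin n))
    (fun y : M => TangentSpace (𝓡 n) y →L[ℝ] TangentSpace (𝓡 n) y) R x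

theorem flatDerivEnd_apply (R : ∀ x : M, TangentSpace (𝓡 n) x →L[ℝ] TangentSpace (𝓡 n) x) (x : M)
    (u v : TangentSpace (𝓡 n) x) :
    flatDerivEnd n R x u v = mvfderiv (𝓡 n) (localExpr
      (EuclideanSpace ℝ (Fin n) →L[ℝ] EuclideanSpace ℝ (Fin n)) x R) x u v := by
  have hx := mem_baseSet_trivializationAt (EuclideanSpace ℝ (Fin n)) (TangentSpace (𝓡 n)) x
  rw [flatDerivEnd, flatConnection_apply, symmL_hom_apply hx hx]
  refine (symmL_tangent_self (I := 𝓡 n) x _).trans ?_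
  exact congrArg _ (continuousLinearMapAt_tangent_self (I := 𝓡 n) x v)

theorem nablaJ_eq_christoffel (J : AlmostComplexStructure n M) (D : Connection n M) (x : M)
    (u v : TangentSpace (𝓡 n) x) :
    nablaJ J D x u v =
      flatDerivEnd n J x u v + christoffel D x (J x v) u - J x (christoffel D x v u) := by
  have hJ := (J.smooth x).mdifferentiableAt (by simp)
  have hv := mdifferentiableAt_extend (𝓡 n) (EuclideanSpace ℝ (Fin n)) v
  have h := nablaJ_apply J D x (extend (EuclideanSpace ℝ (Fin n)) u) _ hv
  rw [covariantDerivative_apply D (hJ.clm_bundle_apply hv), covariantDerivative_apply D hv,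
    flatConnection_clm_apply hJ hv, map_add] at h
  simp only [extend_apply_self] at h
  rw [h]
  abel

end Base

section CotangentChart

variable {n : ℕ} {M : Type*} [TopologicalSpace M] [ChartedSpace (EuclideanSpace ℝ (Fin n)) M]
  [IsManifold (𝓡 n) ∞ M]

theorem trivializationAt_cotangent_snd_apply (x₀ : M) (ζ : CotangentBundle n M)
    (v : EuclideanSpace ℝ (Fin n)) :
    (trivializationAt (Dual n) (CotangentSpace n) x₀ ζ).2 v = ζ.snd ((trivializationAt
      (EuclideanSpace ℝ (Fin n)) (TangentSpace (𝓡 n)) x₀).symmL ℝ ζ.proj v) := by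
  rw [hom_trivializationAt_apply, ContinuousLinearMap.inCoordinates]
  simp

theorem trivializationAt_cotangent_snd_self (x : M) (p : CotangentSpace n x) :
    (trivializationAt (Dual n) (CotangentSpace n) x ⟨x, p⟩).2 = p := by
  refine ContinuousLinearMap.ext fun v => ?_
  rw [trivializationAt_cotangent_snd_apply]
  exact congrArg p (symmL_tangent_self (I := 𝓡 n) x v)

theorem dπ_apply (ξ : CotangentBundle n M) (v : EuclideanSpace ℝ (Fin n) × Dual n) :
    dπ ξ (v : TangentSpace (cotModel n) ξ) = v.1 :=
  mfderiv_proj_apply ξ v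

theorem vert_apply (ξ : CotangentBundle n M) (p : CotangentSpace n ξ.proj) :
    vert ξ p = ((0, p) : EuclideanSpace ℝ (Fin n) × Dual n) := by
  obtain ⟨x, q⟩ := ξ
  let q' : Dual n := q
  let ι : Dual n → CotangentBundle n M := fun p => TotalSpace.mk x p
  have hι : MDifferentiableAt 𝓘(ℝ, Dual n) (cotModel n) ι q' :=
    (mdifferentiableAt_totalSpace (𝓡 n) _).2 ⟨mdifferentiableAt_const,
      mdifferentiableAt_id.congr_of_eventuallyEq
        (Filter.Eventually.of_forall (trivializationAt_cotangent_snd_self x))⟩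
  have hψ : HasMFDerivAt (cotModel n) 𝓘(ℝ, EuclideanSpace ℝ (Fin n) × Dual n)
      (extChartAt (cotModel n) (ι q')) (ι q') (ContinuousLinearMap.id ℝ _) :=
    mfderiv_extChartAt_self (I := cotModel n) (x := ι q') ▸
      (mdifferentiableAt_extChartAt (mem_chart_source _ _)).hasMFDerivAt
  have hψι : extChartAt (cotModel n) (ι q') ∘ ι = fun r => (extChartAt (𝓡 n) x x, r) :=
    funext fun r => (extChartAt_totalSpace_apply (mem_baseSet_trivializationAt' x)).trans
      (congrArg (Prod.mk (extChartAt (𝓡 n) x x)) (trivializationAt_cotangent_snd_self x r))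
  have hinr : HasMFDerivAt 𝓘(ℝ, Dual n) 𝓘(ℝ, EuclideanSpace ℝ (Fin n) × Dual n)
      (fun r : Dual n => (extChartAt (𝓡 n) x x, r)) q'
      (ContinuousLinearMap.inr ℝ (EuclideanSpace ℝ (Fin n)) (Dual n)) :=
    (hasFDerivAt_prodMk_right (𝕜 := ℝ) (extChartAt (𝓡 n) x x) q').hasMFDerivAt
  have hcomp := hψ.comp q' hι.hasMFDerivAt
  rw [hψι] at hcomp
  exact DFunLike.congr_fun (hasMFDerivAt_unique hcomp hinr) p

end CotangentChart

/-! ### Forms and horizontal vectors in preferred charts of `T*M` -/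

section OneForm

theorem extDeriv_ofSubsingleton_apply {V : Type*} [NormedAddCommGroup V] [NormedSpace ℝ V]
    {f : V → V →L[ℝ] ℝ} {f' : V →L[ℝ] V →L[ℝ] ℝ} {z : V} (hf : HasFDerivAt f f' z) (v w : V) :
    extDeriv (fun z => ContinuousAlternatingMap.ofSubsingleton ℝ V ℝ (0 : Fin 1) (f z)) z ![v, w] =
      f' v w - f' w v := by
  have hdiff : DifferentiableAt ℝ
      (fun z => ContinuousAlternatingMap.ofSubsingleton ℝ V ℝ (0 : Fin 1) (f z)) z :=
    (ContinuousAlternatingMap.ofSubsingletonLIE (𝕜 := ℝ) (E := V) (F := ℝ)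
      (0 : Fin 1)).toContinuousLinearEquiv.differentiableAt.comp z hf.differentiableAt
  have hremove (i : Fin 2) : (i.removeNth ![v, w] : Fin 1 → V) 0 = ![w, v] i := by
    fin_cases i <;> rfl
  have hfderiv (u : V) : fderiv ℝ (fun z => f z u) z = f'.flip u :=
    (hf.clm_apply (hasFDerivAt_const u z)).fderiv.trans (by ext; simp)
  rw [extDeriv_apply hdiff]
  simp only [ContinuousAlternatingMap.ofSubsingleton_apply_apply, hremove, hfderiv]
  simp [sub_eq_add_neg]

theorem extDeriv_pairing {E : Type*} [NormedAddCommGroup E] [NormedSpace ℝ E] {A : E → E →L[ℝ] E}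
    {A' : E →L[ℝ] E →L[ℝ] E} {z : E × (E →L[ℝ] ℝ)} (hA : HasFDerivAt A A' z.1)
    (v w : E × (E →L[ℝ] ℝ)) :
    extDeriv (fun z : E × (E →L[ℝ] ℝ) => ContinuousAlternatingMap.ofSubsingleton ℝ
      (E × (E →L[ℝ] ℝ)) ℝ (0 : Fin 1)
        ((z.2.comp (A z.1)).comp (ContinuousLinearMap.fst ℝ E (E →L[ℝ] ℝ)))) z ![v, w] =
      v.2 (A z.1 w.1) - w.2 (A z.1 v.1) + z.2 (A' v.1 w.1 - A' w.1 v.1) := by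
  have hsnd : HasFDerivAt Prod.snd (ContinuousLinearMap.snd ℝ E (E →L[ℝ] ℝ)) z := hasFDerivAt_snd
  have hpair := (hsnd.clm_comp (hA.comp z hasFDerivAt_fst)).clm_comp
    (hasFDerivAt_const (ContinuousLinearMap.fst ℝ E (E →L[ℝ] ℝ)) z)
  refine (extDeriv_ofSubsingleton_apply hpair v w).trans ?_
  simp only [Function.comp_apply, ContinuousLinearMap.comp_zero, ContinuousLinearMap.comp_add,
    zero_add, add_apply, ContinuousLinearMap.comp_apply, ContinuousLinearMap.coe_fst',
    ContinuousLinearMap.compL_apply, ContinuousLinearMap.flip_apply,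
    ContinuousLinearMap.coe_snd', map_sub]
  ring

variable {n : ℕ} {M : Type*} [TopologicalSpace M] [ChartedSpace (EuclideanSpace ℝ (Fin n)) M]
  [IsManifold (𝓡 n) ∞ M]

theorem dπ_mfderiv_extChartAt_symm {ξ : CotangentBundle n M}
    {z : EuclideanSpace ℝ (Fin n) × Dual n} (hz : z ∈ (extChartAt (cotModel n) ξ).target)
    (v : EuclideanSpace ℝ (Fin n) × Dual n) :
    dπ ((extChartAt (cotModel n) ξ).symm z)
        (mfderiv 𝓘(ℝ, EuclideanSpace ℝ (Fin n) × Dual n) (cotModel n)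
          (extChartAt (cotModel n) ξ).symm z v) =
      (trivializationAt (EuclideanSpace ℝ (Fin n)) (TangentSpace (𝓡 n)) ξ.proj).symmL ℝ
        ((extChartAt (cotModel n) ξ).symm z).proj v.1 := by
  have hsource := (extChartAt (cotModel n) ξ).map_target hz
  have hbase := (mem_extChartAt_totalSpace_source.1 hsource).2
  have hproj := mfderiv_extChartAt_comp_mfderiv_proj hsource
  have hinv := mfderiv_extChartAt_comp_mfderivWithin_extChartAt_symm hz
  rw [ModelWithCorners.Boundaryless.range_eq_univ, mfderivWithin_univ] at hinv
  rw [← TangentBundle.continuousLinearMapAt_trivializationAt hbase] at hproj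
  let g : EuclideanSpace ℝ (Fin n) × Dual n →L[ℝ] EuclideanSpace ℝ (Fin n) × Dual n :=
    mfderiv 𝓘(ℝ, EuclideanSpace ℝ (Fin n) × Dual n) (cotModel n)
      (extChartAt (cotModel n) ξ).symm z
  have hfst : (trivializationAt (EuclideanSpace ℝ (Fin n)) (TangentSpace (𝓡 n))
      ξ.proj).continuousLinearMapAt ℝ _ (dπ _ (g v)) = v.1 :=
    (DFunLike.congr_fun hproj (g v)).trans (congrArg Prod.fst (DFunLike.congr_fun hinv v))
  rw [← hfst]
  exact (Trivialization.symmL_continuousLinearMapAt _ hbase _).symm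

theorem oneFormInChart_thetaForm (R : ∀ x : M, TangentSpace (𝓡 n) x →L[ℝ] TangentSpace (𝓡 n) x)
    {ξ : CotangentBundle n M} {z : EuclideanSpace ℝ (Fin n) × Dual n}
    (hz : z ∈ (extChartAt (cotModel n) ξ).target) :
    oneFormInChart (cotModel n) (thetaForm R) ξ z =
      ContinuousAlternatingMap.ofSubsingleton ℝ (EuclideanSpace ℝ (Fin n) × Dual n) ℝ (0 : Fin 1)
        ((z.2.comp (localExpr (EuclideanSpace ℝ (Fin n) →L[ℝ] EuclideanSpace ℝ (Fin n)) ξ.proj R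
          ((extChartAt (𝓡 n) ξ.proj).symm z.1))).comp
            (ContinuousLinearMap.fst ℝ (EuclideanSpace ℝ (Fin n)) (Dual n))) := by
  let ζ := (extChartAt (cotModel n) ξ).symm z
  have hζ := mem_extChartAt_totalSpace_source.1 ((extChartAt (cotModel n) ξ).map_target hz)
  have hz' : z = (extChartAt (𝓡 n) ξ.proj ζ.proj,
      (trivializationAt (Dual n) (CotangentSpace n) ξ.proj ζ).2) :=
    ((extChartAt (cotModel n) ξ).right_inv hz).symm.trans (extChartAt_totalSpace_apply hζ.1)
  have hζ' : (extChartAt (𝓡 n) ξ.proj).symm z.1 = ζ.proj :=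
    (congrArg _ (congrArg Prod.fst hz')).trans
      ((extChartAt (𝓡 n) ξ.proj).left_inv (by simpa only [extChartAt_source] using hζ.2))
  refine congrArg (ContinuousAlternatingMap.ofSubsingleton ℝ _ ℝ (0 : Fin 1))
    (ContinuousLinearMap.ext fun v => ?_)
  refine (congrArg (fun u => ζ.snd (R ζ.proj u)) (dπ_mfderiv_extChartAt_symm hz v)).trans ?_
  rw [hζ']
  simp only [ContinuousLinearMap.comp_apply, ContinuousLinearMap.coe_fst']
  rw [congrArg Prod.snd hz', trivializationAt_cotangent_snd_apply, localExpr_hom,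
    Trivialization.symmL_continuousLinearMapAt _ hζ.2]

theorem extDerivOneForm_thetaForm {R : ∀ x : M, TangentSpace (𝓡 n) x →L[ℝ] TangentSpace (𝓡 n) x}
    {ξ : CotangentBundle n M} (hR : MDifferentiableAt (𝓡 n)
      ((𝓡 n).prod 𝓘(ℝ, EuclideanSpace ℝ (Fin n) →L[ℝ] EuclideanSpace ℝ (Fin n)))
      (fun x => TotalSpace.mk' (EuclideanSpace ℝ (Fin n) →L[ℝ] EuclideanSpace ℝ (Fin n))
        (E := fun y : M => TangentSpace (𝓡 n) y →L[ℝ] TangentSpace (𝓡 n) y) x (R x)) ξ.proj)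
    (v w : EuclideanSpace ℝ (Fin n) × Dual n) :
    extDerivOneForm (cotModel n) (thetaForm R) ξ v w =
      v.2 (R ξ.proj w.1) - w.2 (R ξ.proj v.1) +
        ξ.snd (flatDerivEnd n R ξ.proj v.1 w.1 - flatDerivEnd n R ξ.proj w.1 v.1) := by
  let R₀ := localExpr (EuclideanSpace ℝ (Fin n) →L[ℝ] EuclideanSpace ℝ (Fin n)) ξ.proj R
  let R' : EuclideanSpace ℝ (Fin n) →L[ℝ] EuclideanSpace ℝ (Fin n) →L[ℝ]
    EuclideanSpace ℝ (Fin n) := mvfderiv (𝓡 n) R₀ ξ.proj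
  have hderiv : HasFDerivAt (R₀ ∘ (extChartAt (𝓡 n) ξ.proj).symm) R'
      (extChartAt (𝓡 n) ξ.proj ξ.proj) := by
    rw [← hasFDerivWithinAt_univ, ← ModelWithCorners.Boundaryless.range_eq_univ (I := 𝓡 n)]
    exact hasFDerivWithinAt_comp_extChartAt_symm (mdifferentiableAt_localExpr hR)
  have hcenter : extChartAt (cotModel n) ξ ξ = (extChartAt (𝓡 n) ξ.proj ξ.proj, ξ.snd) :=
    (extChartAt_totalSpace_apply (mem_baseSet_trivializationAt' ξ.proj)).trans
      (congrArg _ (trivializationAt_cotangent_snd_self ξ.proj ξ.snd))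
  have hlocal : oneFormInChart (cotModel n) (thetaForm R) ξ =ᶠ[nhds (extChartAt (cotModel n) ξ ξ)]
      _ := Filter.eventuallyEq_of_mem (extChartAt_target_mem_nhds ξ)
        fun z hz => oneFormInChart_thetaForm R hz
  have hself : R₀ ξ.proj = R ξ.proj := by
    refine ContinuousLinearMap.ext fun v => ?_
    rw [localExpr_hom]
    exact (continuousLinearMapAt_tangent_self (I := 𝓡 n) ξ.proj _).trans
      (congrArg (R ξ.proj) (symmL_tangent_self (I := 𝓡 n) ξ.proj v))
  let A : EuclideanSpace ℝ (Fin n) × Dual n →L[ℝ] EuclideanSpace ℝ (Fin n) × Dual n :=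
    mfderiv (cotModel n) 𝓘(ℝ, EuclideanSpace ℝ (Fin n) × Dual n) (extChartAt (cotModel n) ξ) ξ
  have hA : A = ContinuousLinearMap.id ℝ _ := mfderiv_extChartAt_self
  change extDeriv _ _ ![A v, A w] = _
  rw [hA, hlocal.extDeriv_eq, hcenter]
  refine (extDeriv_pairing (z := (extChartAt (𝓡 n) ξ.proj ξ.proj, ξ.snd)) hderiv v w).trans ?_
  rw [Function.comp_apply, extChartAt_to_inv, hself]
  exact congrArg (fun t => v.2 (R ξ.proj w.1) - w.2 (R ξ.proj v.1) + ξ.snd t)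
    (congrArg₂ (· - ·) (flatDerivEnd_apply R ξ.proj v.1 w.1).symm
      (flatDerivEnd_apply R ξ.proj w.1 v.1).symm)

theorem mdifferentiableAt_id_end (x : M) : MDifferentiableAt (𝓡 n)
    ((𝓡 n).prod 𝓘(ℝ, EuclideanSpace ℝ (Fin n) →L[ℝ] EuclideanSpace ℝ (Fin n)))
    (fun x => TotalSpace.mk' (EuclideanSpace ℝ (Fin n) →L[ℝ] EuclideanSpace ℝ (Fin n))
      (E := fun y : M => TangentSpace (𝓡 n) y →L[ℝ] TangentSpace (𝓡 n) y) x
      (ContinuousLinearMap.id ℝ (TangentSpace (𝓡 n) x))) x := by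
  refine (mdifferentiableAt_hom_bundle _).2 ⟨mdifferentiableAt_id,
    (mdifferentiableAt_const (c := ContinuousLinearMap.id ℝ
      (EuclideanSpace ℝ (Fin n)))).congr_of_eventuallyEq ?_⟩
  filter_upwards [eventually_mem_baseSet (F := EuclideanSpace ℝ (Fin n))
    (V := (TangentSpace (𝓡 n) : M → Type)) x] with y hy
  ext1 v
  exact Trivialization.continuousLinearMapAt_symmL _ hy v

theorem flatDerivEnd_id (x : M) :
    flatDerivEnd n (fun y : M => ContinuousLinearMap.id ℝ (TangentSpace (𝓡 n) y)) x = 0 := by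
  refine ContinuousLinearMap.ext fun u => ContinuousLinearMap.ext fun v => ?_
  have h := flatConnection_clm_apply (mdifferentiableAt_id_end x)
    (mdifferentiableAt_extend (𝓡 n) (EuclideanSpace ℝ (Fin n)) v) u
  simpa using h

theorem omegaSt_apply (ξ : CotangentBundle n M) (v w : EuclideanSpace ℝ (Fin n) × Dual n) :
    omegaSt ξ v w = v.2 w.1 - w.2 v.1 := by
  have h := extDerivOneForm_thetaForm (mdifferentiableAt_id_end ξ.proj) v w
  rw [flatDerivEnd_id] at h
  refine h.trans (Eq.trans (congrArg (v.2 w.1 - w.2 v.1 + ξ.snd ·) (sub_self 0)) ?_)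
  rw [map_zero, add_zero]

end OneForm

section Horizontal

variable {n : ℕ} {M : Type*} [TopologicalSpace M] [ChartedSpace (EuclideanSpace ℝ (Fin n)) M]
  [IsManifold (𝓡 n) ∞ M]

theorem dualCov_eq_christoffel (D : Connection n M) {s : ∀ x : M, CotangentSpace n x}
    {Y : ∀ x : M, TangentSpace (𝓡 n) x} {x : M}
    (hs : MDifferentiableAt (𝓡 n) (cotModel n)
      (fun x => (TotalSpace.mk x (s x) : CotangentBundle n M)) x)
    (hY : MDifferentiableAt (𝓡 n) (𝓡 n).tangent
      (fun y => (TotalSpace.mk y (Y y) : TangentBundle (𝓡 n) M)) x) (u : TangentSpace (𝓡 n) x) :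
    dualCov D s Y x u = mvfderiv (𝓡 n) (localExpr (Dual n) x s) x u (Y x) -
      (s x (christoffel D x (Y x) u) : ℝ) := by
  have hpair : (fun y => (s y (Y y) : ℝ)) =ᶠ[nhds x]
      fun y => localExpr (Dual n) x s y (localExpr (EuclideanSpace ℝ (Fin n)) x Y y) := by
    filter_upwards [eventually_mem_baseSet (F := EuclideanSpace ℝ (Fin n))
      (V := (TangentSpace (𝓡 n) : M → Type)) x] with y hy
    rw [localExpr, trivializationAt_cotangent_snd_apply,
      ← continuousLinearMapAt_eq_localExpr ℝ Y hy, Trivialization.symmL_continuousLinearMapAt _ hy]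
  have hself : localExpr (Dual n) x s x = s x := trivializationAt_cotangent_snd_self x (s x)
  rw [dualCov, mvfderiv_congr hpair, mvfderiv_clm_apply (mdifferentiableAt_localExpr hs)
    (mdifferentiableAt_localExpr hY), localExpr_tangent_self, hself,
    covariantDerivative_apply D hY, flatConnection_tangent_apply]
  refine (congrArg (_ - ·) ((map_add (s x) _ _).trans (add_comm _ _))).trans ?_
  exact add_sub_add_right_eq_sub _ _ _

theorem mem_horizontalSpace_iff [T2Space M] (D : Connection n M) (ξ : CotangentBundle n M)
    (Z : EuclideanSpace ℝ (Fin n) × Dual n) :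
    (Z : TangentSpace (cotModel n) ξ) ∈ horizontalSpace D ξ ↔
      ∀ v : EuclideanSpace ℝ (Fin n), Z.2 v = ξ.snd (christoffel D ξ.proj v Z.1) := by
  obtain ⟨x, p⟩ := ξ
  constructor
  · rintro ⟨s, u, hs, hparallel, htangent⟩ v
    obtain rfl : s x = p := by
      simpa [tangentMap] using congrArg TotalSpace.proj htangent
    have hs' := (hs x).mdifferentiableAt (by simp)
    have hZ : ((u, mvfderiv (𝓡 n) (localExpr (Dual n) x s) x u) :
        EuclideanSpace ℝ (Fin n) × Dual n) = Z :=
      (mfderiv_section_apply hs' u).symm.trans (TotalSpace.mk_inj.1 htangent)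
    obtain ⟨Y, hY, hYx, -⟩ := exists_contMDiff_section_mvfderiv_localExpr_eq (I := 𝓡 n)
      (V := (TangentSpace (𝓡 n) : M → Type)) x v
      (0 : EuclideanSpace ℝ (Fin n) →L[ℝ] EuclideanSpace ℝ (Fin n))
    have h := hparallel Y hY
    rw [dualCov_eq_christoffel D hs' ((hY x).mdifferentiableAt (by simp)), sub_eq_zero, hYx] at h
    rw [← hZ]
    exact h
  · intro h
    obtain ⟨s, hs, rfl, hderiv⟩ := exists_contMDiff_section_mvfderiv_localExpr_eq (I := 𝓡 n)
      (V := (CotangentSpace n : M → Type)) x p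
      ((ContinuousLinearMap.compL ℝ (EuclideanSpace ℝ (Fin n)) (EuclideanSpace ℝ (Fin n)) ℝ
        p).comp (swapArgs (christoffel D x)) : EuclideanSpace ℝ (Fin n) →L[ℝ] Dual n)
    have hs' := (hs x).mdifferentiableAt (by simp)
    refine ⟨s, Z.1, hs, fun Y hY => ?_, ?_⟩
    · refine (dualCov_eq_christoffel D hs' ((hY x).mdifferentiableAt (by simp)) Z.1).trans ?_
      rw [hderiv]
      exact sub_self _
    · refine TotalSpace.mk_inj.2 ((mfderiv_section_apply hs' Z.1).trans (Prod.ext rfl ?_))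
      rw [hderiv]
      exact ContinuousLinearMap.ext fun v => (h v).symm

end Horizontal

/-! ### The splitting of `T(T*M)` defined by a connection -/

section Splitting

variable {n : ℕ} {M : Type*} [TopologicalSpace M] [ChartedSpace (EuclideanSpace ℝ (Fin n)) M]
  [IsManifold (𝓡 n) ∞ M]

/-- The splitting `TₓM × T*ₓM ≃ T_ξ T*M`, `x = π(ξ)`, defined by a connection: it maps `(u, α)` to
the sum of the horizontal lift of `u` and of the vertical vector `α`. In the preferred chart at `ξ`
this is `(u, α + ξ(Γ(·, u)))`. -/
def splitting (D : Connection n M) (ξ : CotangentBundle n M) :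
    (TangentSpace (𝓡 n) ξ.proj × CotangentSpace n ξ.proj) ≃L[ℝ] TangentSpace (cotModel n) ξ :=
  ContinuousLinearEquiv.skewProd (M := EuclideanSpace ℝ (Fin n)) (M₃ := Dual n)
    (ContinuousLinearEquiv.refl ℝ (EuclideanSpace ℝ (Fin n)))
    (ContinuousLinearEquiv.refl ℝ (Dual n))
    ((ContinuousLinearMap.compL ℝ (EuclideanSpace ℝ (Fin n)) (EuclideanSpace ℝ (Fin n)) ℝ
      ξ.snd).comp (swapArgs (christoffel D ξ.proj)))

theorem splitting_apply_snd_apply (D : Connection n M) (ξ : CotangentBundle n M)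
    (a : TangentSpace (𝓡 n) ξ.proj × CotangentSpace n ξ.proj) (v : EuclideanSpace ℝ (Fin n)) :
    (splitting D ξ a : EuclideanSpace ℝ (Fin n) × Dual n).2 v =
      a.2 v + ξ.snd (christoffel D ξ.proj v a.1) :=
  rfl

theorem dπ_splitting (D : Connection n M) (ξ : CotangentBundle n M)
    (a : TangentSpace (𝓡 n) ξ.proj × CotangentSpace n ξ.proj) : dπ ξ (splitting D ξ a) = a.1 :=
  dπ_apply ξ _

theorem splitting_zero_left (D : Connection n M) (ξ : CotangentBundle n M)
    (α : CotangentSpace n ξ.proj) : splitting D ξ (0, α) = vert ξ α := by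
  have h : (splitting D ξ (0, α) : EuclideanSpace ℝ (Fin n) × Dual n) = (0, α) := by
    refine Prod.ext rfl (ContinuousLinearMap.ext fun v => ?_)
    refine (splitting_apply_snd_apply D ξ (0, α) v).trans ?_
    rw [map_zero, map_zero, add_zero]
    rfl
  exact h.trans (vert_apply ξ α).symm

theorem mem_horizontalSpace_iff_exists_splitting [T2Space M] (D : Connection n M)
    (ξ : CotangentBundle n M) (Z : TangentSpace (cotModel n) ξ) :
    Z ∈ horizontalSpace D ξ ↔ ∃ u, splitting D ξ (u, 0) = Z := by
  refine (mem_horizontalSpace_iff D ξ Z).trans ⟨fun h => ⟨Z.1, ?_⟩, ?_⟩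
  · refine Prod.ext rfl (ContinuousLinearMap.ext fun v => ?_)
    exact (splitting_apply_snd_apply D ξ (Z.1, 0) v).trans ((zero_add _).trans (h v).symm)
  · rintro ⟨u, rfl⟩ v
    exact (splitting_apply_snd_apply D ξ (u, 0) v).trans (zero_add _)

/-- `K` is the product structure `J ⊕ ᵗJ` in the splittings `T_ξ T*M ≃ TₓM × T*ₓM` defined by
`D`. -/
def IsProductInSplitting (J : AlmostComplexStructure n M) (D : Connection n M)
    (K : EndField n M) : Prop :=
  ∀ ξ u α, K ξ (splitting D ξ (u, α)) = splitting D ξ (J ξ.proj u, α.comp (J ξ.proj))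

theorem existsUnique_isProductInSplitting (J : AlmostComplexStructure n M) (D : Connection n M) :
    ∃! K, IsProductInSplitting J D K := by
  refine ⟨fun ξ => (splitting D ξ).toContinuousLinearMap.comp
      (((J ξ.proj).prodMap ((ContinuousLinearMap.compL ℝ (EuclideanSpace ℝ (Fin n))
        (EuclideanSpace ℝ (Fin n)) ℝ).flip (J ξ.proj))).comp
          (splitting D ξ).symm.toContinuousLinearMap), fun ξ u α => ?_, fun K hK => ?_⟩
  · exact congrArg (fun a => splitting D ξ (J ξ.proj a.1, a.2.comp (J ξ.proj)))
      ((splitting D ξ).symm_apply_apply (u, α))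
  · refine funext fun ξ => ContinuousLinearMap.ext fun Z => ?_
    exact (congrArg (K ξ) ((splitting D ξ).apply_symm_apply Z).symm).trans (hK ξ _ _)

theorem isGeneralizedHorizontalLift_iff [T2Space M] (J : AlmostComplexStructure n M)
    (D : Connection n M) (K : EndField n M) :
    IsGeneralizedHorizontalLift J D K ↔ IsProductInSplitting J D K := by
  have hadd (ξ : CotangentBundle n M) (u : TangentSpace (𝓡 n) ξ.proj)
      (α : CotangentSpace n ξ.proj) :
      splitting D ξ (u, 0) + vert ξ α = splitting D ξ (u, α) := by
    rw [← splitting_zero_left D, ← map_add, Prod.mk_add_mk, add_zero, zero_add]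
  refine forall_congr' fun ξ => ⟨fun h u α => ?_, fun h Z hZ Z' hZ' hJ α => ?_⟩
  · rw [← hadd ξ u, ← hadd ξ (J ξ.proj u)]
    refine h _ ((mem_horizontalSpace_iff_exists_splitting D ξ _).2 ⟨u, rfl⟩) _
      ((mem_horizontalSpace_iff_exists_splitting D ξ _).2 ⟨J ξ.proj u, rfl⟩) ?_ α
    rw [dπ_splitting, dπ_splitting]
  · obtain ⟨u, rfl⟩ := (mem_horizontalSpace_iff_exists_splitting D ξ Z).1 hZ
    obtain ⟨u', rfl⟩ := (mem_horizontalSpace_iff_exists_splitting D ξ Z').1 hZ'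
    rw [dπ_splitting, dπ_splitting] at hJ
    obtain rfl : u' = J ξ.proj u := hJ
    rw [hadd, hadd, h]

theorem omegaSt_splitting (D : Connection n M) (ξ : CotangentBundle n M)
    (u v : TangentSpace (𝓡 n) ξ.proj) (α β : CotangentSpace n ξ.proj) :
    omegaSt ξ (splitting D ξ (u, α)) (splitting D ξ (v, β)) =
      α v - β u + ξ.snd (D.torsion ξ.proj u v) := by
  refine (omegaSt_apply ξ _ _).trans ?_
  rw [torsion_eq_christoffel, map_sub]
  change (α v + ξ.snd (christoffel D ξ.proj v u) : ℝ) - (β u + ξ.snd (christoffel D ξ.proj u v)) = _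
  ring

theorem extDerivOneForm_thetaForm_splitting (J : AlmostComplexStructure n M) (D : Connection n M)
    (ξ : CotangentBundle n M) (u v : TangentSpace (𝓡 n) ξ.proj) (α β : CotangentSpace n ξ.proj) :
    extDerivOneForm (cotModel n) (thetaForm (n := n) (M := M) J) ξ
        (splitting D ξ (u, α)) (splitting D ξ (v, β)) =
      α (J ξ.proj v) - β (J ξ.proj u) +
        ξ.snd (J ξ.proj (D.torsion ξ.proj u v) - bracketNablaJ J D ξ.proj u v) := by
  have h := extDerivOneForm_thetaForm ((J.smooth ξ.proj).mdifferentiableAt (by simp))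
    (splitting D ξ (u, α)) (splitting D ξ (v, β))
  refine h.trans ?_
  have hbracket : bracketNablaJ J D ξ.proj u v =
    -nablaJ J D ξ.proj u v + nablaJ J D ξ.proj v u := rfl
  rw [hbracket, nablaJ_eq_christoffel, nablaJ_eq_christoffel, torsion_eq_christoffel]
  change (α (J ξ.proj v) + ξ.snd (christoffel D ξ.proj (J ξ.proj v) u) : ℝ) -
    (β (J ξ.proj u) + ξ.snd (christoffel D ξ.proj (J ξ.proj u) v)) +
      ξ.snd (flatDerivEnd n J ξ.proj u v - flatDerivEnd n J ξ.proj v u) = _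
  simp only [map_sub, map_add, map_neg]
  ring

theorem eq_of_forall_omegaSt_eq {ξ : CotangentBundle n M} {Y Y' : TangentSpace (cotModel n) ξ}
    (h : ∀ Z, omegaSt ξ Y Z = omegaSt ξ Y' Z) : Y = Y' := by
  have h' (w : EuclideanSpace ℝ (Fin n) × Dual n) : Y.2 w.1 - w.2 Y.1 = Y'.2 w.1 - w.2 Y'.1 :=
    (omegaSt_apply ξ Y w).symm.trans ((h w).trans (omegaSt_apply ξ Y' w))
  refine Prod.ext ((SeparatingDual.eq_iff_forall_dual_eq (R := ℝ)).2 fun q => ?_)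
    (ContinuousLinearMap.ext fun e => ?_)
  · simpa using h' (0, q)
  · simpa using h' (e, 0)

end Splitting

section Lifts

variable {n : ℕ} {M : Type*} [TopologicalSpace M] [ChartedSpace (EuclideanSpace ℝ (Fin n)) M]
  [IsManifold (𝓡 n) ∞ M]

/-- The tensor `S(u, v) = [DJ](u, v) + T(Ju, v) - J T(u, v)`, where `T` is the torsion of `D`:
the obstruction to `Jᶜ` being the product structure `J ⊕ ᵗJ` in the splitting defined by `D`. -/
def liftDefect (J : AlmostComplexStructure n M) (D : Connection n M) (x : M) :
    TangentSpace (𝓡 n) x →L[ℝ] TangentSpace (𝓡 n) x →L[ℝ] TangentSpace (𝓡 n) x :=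
  let A : EuclideanSpace ℝ (Fin n) →L[ℝ] EuclideanSpace ℝ (Fin n) := J x
  let T : EuclideanSpace ℝ (Fin n) →L[ℝ] EuclideanSpace ℝ (Fin n) →L[ℝ]
    EuclideanSpace ℝ (Fin n) := D.torsion x
  let B : EuclideanSpace ℝ (Fin n) →L[ℝ] EuclideanSpace ℝ (Fin n) →L[ℝ]
    EuclideanSpace ℝ (Fin n) := bracketNablaJ J D x
  B + T.comp A - (ContinuousLinearMap.compL ℝ (EuclideanSpace ℝ (Fin n))
    (EuclideanSpace ℝ (Fin n)) (EuclideanSpace ℝ (Fin n)) A).comp T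

theorem liftDefect_apply (J : AlmostComplexStructure n M) (D : Connection n M) (x : M)
    (u v : TangentSpace (𝓡 n) x) :
    liftDefect J D x u v =
      bracketNablaJ J D x u v + D.torsion x (J x u) v - J x (D.torsion x u v) :=
  rfl

theorem liftDefect_eq_bracketNablaJ {J : AlmostComplexStructure n M} {D : Connection n M}
    (hD : D.torsion = 0) : liftDefect J D = bracketNablaJ J D := by
  funext x
  refine ContinuousLinearMap.ext fun u => ContinuousLinearMap.ext fun v => ?_
  simp [liftDefect_apply, hD]

theorem gammaContraction_splitting
    (R : ∀ x : M, TangentSpace (𝓡 n) x →L[ℝ] TangentSpace (𝓡 n) x →L[ℝ] TangentSpace (𝓡 n) x)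
    (D : Connection n M) (ξ : CotangentBundle n M)
    (a : TangentSpace (𝓡 n) ξ.proj × CotangentSpace n ξ.proj) :
    gammaContraction R ξ (splitting D ξ a) = splitting D ξ (0, ξ.snd.comp (R ξ.proj a.1)) :=
  (congrArg (fun u => vert ξ (ξ.snd.comp (R ξ.proj u))) (dπ_splitting D ξ a)).trans
    (splitting_zero_left D ξ _).symm

theorem extDerivOneForm_thetaForm_eq_omegaSt (J : AlmostComplexStructure n M)
    (D : Connection n M) (ξ : CotangentBundle n M) (u : TangentSpace (𝓡 n) ξ.proj)
    (α : CotangentSpace n ξ.proj) (Z : TangentSpace (cotModel n) ξ) :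
    extDerivOneForm (cotModel n) (thetaForm (n := n) (M := M) J) ξ (splitting D ξ (u, α)) Z =
      omegaSt ξ (splitting D ξ
        (J ξ.proj u, α.comp (J ξ.proj) - ξ.snd.comp (liftDefect J D ξ.proj u))) Z := by
  obtain ⟨⟨v, β⟩, rfl⟩ := (splitting D ξ).surjective Z
  rw [extDerivOneForm_thetaForm_splitting, omegaSt_splitting]
  simp only [sub_apply, ContinuousLinearMap.comp_apply, liftDefect_apply, map_add, map_sub]
  ring

theorem isCompleteLift_iff (J : AlmostComplexStructure n M) (D : Connection n M)
    (K : EndField n M) :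
    IsCompleteLift J K ↔ IsProductInSplitting J D
      (fun ξ => K ξ + gammaContraction (liftDefect J D) ξ) := by
  have hsub (ξ : CotangentBundle n M) (u : TangentSpace (𝓡 n) ξ.proj)
      (α : CotangentSpace n ξ.proj) :
      (K ξ + gammaContraction (liftDefect J D) ξ) (splitting D ξ (u, α)) =
          splitting D ξ (J ξ.proj u, α.comp (J ξ.proj)) ↔
        K ξ (splitting D ξ (u, α)) = splitting D ξ
          (J ξ.proj u, α.comp (J ξ.proj) - ξ.snd.comp (liftDefect J D ξ.proj u)) := by
    rw [add_apply, gammaContraction_splitting, ← eq_sub_iff_add_eq, ← map_sub, Prod.mk_sub_mk,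
      sub_zero]
  refine forall_congr' fun ξ => ⟨fun h u α => ?_, fun h Y Z => ?_⟩
  · exact (hsub ξ u α).2 (eq_of_forall_omegaSt_eq fun Z =>
      (h _ Z).symm.trans (extDerivOneForm_thetaForm_eq_omegaSt J D ξ u α Z))
  · obtain ⟨⟨u, α⟩, rfl⟩ := (splitting D ξ).surjective Y
    rw [(hsub ξ u α).1 (h u α), extDerivOneForm_thetaForm_eq_omegaSt]

theorem existsUnique_isCompleteLift (J : AlmostComplexStructure n M) :
    ∃! K, IsCompleteLift J K := by
  let D : Connection n M :=
    flatConnection (𝓡 n) (EuclideanSpace ℝ (Fin n)) (TangentSpace (𝓡 n) : M → Type)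
  let S : EndField n M := gammaContraction (liftDefect J D)
  obtain ⟨K, hK, hunique⟩ := existsUnique_isProductInSplitting J D
  refine ⟨K - S, (isCompleteLift_iff J D _).2 ?_, fun K' hK' =>
    eq_sub_of_add_eq (hunique _ ((isCompleteLift_iff J D K').1 hK'))⟩
  change IsProductInSplitting J D (K - S + S)
  rwa [sub_add_cancel]

theorem existsUnique_isGeneralizedHorizontalLift [T2Space M] (J : AlmostComplexStructure n M)
    (D : Connection n M) : ∃! K, IsGeneralizedHorizontalLift J D K := by
  simpa only [isGeneralizedHorizontalLift_iff] using existsUnique_isProductInSplitting J D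

end Lifts

end CotangentLift

end

theorem mainTheorem10_general {n : ℕ} {M : Type*} [TopologicalSpace M] [T2Space M]
    [ChartedSpace (EuclideanSpace ℝ (Fin n)) M] [IsManifold (𝓡 n) ∞ M]
    (J : CotangentLift.AlmostComplexStructure n M) (D : CotangentLift.Connection n M) :
    (∃! K, CotangentLift.IsCompleteLift J K) ∧
    (∃! K, CotangentLift.IsGeneralizedHorizontalLift J D K) ∧
    (fun ξ => CotangentLift.completeLift J ξ +
      CotangentLift.gammaContraction (CotangentLift.liftDefect J D) ξ) =
        CotangentLift.generalizedHorizontalLift J D := by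
  have hcomplete := CotangentLift.existsUnique_isCompleteLift J
  have hhorizontal := CotangentLift.existsUnique_isGeneralizedHorizontalLift J D
  refine ⟨hcomplete, hhorizontal, hhorizontal.unique ?_
    (Classical.epsilon_spec hhorizontal.exists)⟩
  exact (CotangentLift.isGeneralizedHorizontalLift_iff J D _).2
    ((CotangentLift.isCompleteLift_iff J D _).1 (Classical.epsilon_spec hcomplete.exists))

theorem mainTheorem10 {n : ℕ} {M : Type*} [TopologicalSpace M] [T2Space M]
    [ChartedSpace (EuclideanSpace ℝ (Fin n)) M] [IsManifold (𝓡 n) ∞ M]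
    (J : CotangentLift.AlmostComplexStructure n M) (nabla : CotangentLift.Connection n M)
    [CovariantDerivative.ContMDiffCovariantDerivative nabla ∞] :
    (∃! K, CotangentLift.IsCompleteLift J K) ∧
    (∃! K, CotangentLift.IsGeneralizedHorizontalLift J (CotangentLift.symmetrized nabla) K) ∧
    CotangentLift.horizontalLift J nabla =
      CotangentLift.generalizedHorizontalLift J (CotangentLift.symmetrized nabla) := by
  have h := mainTheorem10_general J (CotangentLift.symmetrized nabla)
  rwa [CotangentLift.liftDefect_eq_bracketNablaJ (CotangentLift.torsion_symmetrized nabla)] at h
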